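/- Let $M$ be a compact connected (Hausdorff) smooth manifold of real dimension $2n$. A complex structure on $M$ is an integrable almost complex structure $I$, that is, an endomorphism field $I$ of $TM$ with $I^2=-1$ such that around each point there is a smooth chart with values in $\mathbb C^n$ whose differential carries $I$ to multiplication by $\sqrt{-1}$. The complex manifold $(M,I)$ is called *LCK with potential* if there are a connected Galois holomorphic covering $\pi:\tilde M\to M$ with deck transformation group $\Gamma$, a Kähler form $\Omega$ on $\tilde M$ (with the convention $\Omega(X,Y)=g(X,IY)$), and a smooth function $\varphi:\tilde M\to\mathbb R^{>0}$ such that 1. $\varphi$ is proper as a map to $\mathbb R^{>0}$; 2. for every $\gamma\in\Gamma$ there is a constant $c$ with $\varphi\circ\gamma=c\,\varphi$; 3. $-\sqrt{-1}\,\partial\bar\partial\varphi=\Omega$. **Theorem.** The class of compact LCK manifolds with potential is stable under small deformations of the complex structure: if $(M,I)$ is LCK with potential, then so is $(M,I')$ for every complex structure $I'$ on $M$ sufficiently close to $I$. Precisely, for every $k$ with $1\le k\le\infty$, the set of all complex structures $I$ on $M$ for which $(M,I)$ is LCK with potential is open in the space of complex structures on $M$ with the $C^k$ topology (uniform convergence,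 on compact subsets of charts, of the coordinate expressions and of their derivatives of order at most $k$). -/

import Mathlib

open scoped Manifold ContDiff Topology

universe u v

noncomputable section

section Forms

variable {E : Type v} [NormedAddCommGroup E] [NormedSpace ℝ E]
  {M : Type u} [TopologicalSpace M] [ChartedSpace E M]

variable (E M) in
/-- Real differential `k`-forms on the manifold `M` (modelled on the real vector space `E`),
with no regularity imposed. -/
abbrev DiffForm (k : ℕ) : Type (max u v) :=
  ∀ x : M, TangentSpace 𝓘(ℝ, E) x [⋀^Fin k]→L[ℝ] ℝ

namespace DiffForm

/-- The expression of a form in the chart `chartAt E p`: its pullback under the inverse chart. It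
is meaningful on the (open) target of that chart. -/
def inChart {k : ℕ} (α : DiffForm E M k) (p : M) (y : E) : E [⋀^Fin k]→L[ℝ] ℝ :=
  (α ((chartAt E p).symm y)).compContinuousLinearMap
    (mfderiv 𝓘(ℝ, E) 𝓘(ℝ, E) (chartAt E p).symm y)

/-- A form is smooth if its expression in every chart is smooth. -/
def IsSmooth {k : ℕ} (α : DiffForm E M k) : Prop :=
  ∀ p : M, ContDiffOn ℝ ∞ (inChart α p) (chartAt E p).target

/-- The exterior derivative of a form, computed at `x` in the chart at `x`. -/
def extDer {k : ℕ} (α : DiffForm E M k) : DiffForm E M (k + 1) := fun x =>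
  (extDeriv (inChart α x) (chartAt E x x)).compContinuousLinearMap
    (mfderiv 𝓘(ℝ, E) 𝓘(ℝ, E) (chartAt E x) x)

end DiffForm

end Forms

/-- The differential at `y` of an `E`-valued chart, with values in `E`. -/
def chartDeriv {E : Type v} [NormedAddCommGroup E] [NormedSpace ℂ E]
    {M : Type u} [TopologicalSpace M] [ChartedSpace E M] (e : OpenPartialHomeomorph M E) (y : M) :
    TangentSpace 𝓘(ℝ, E) y →L[ℝ] E :=
  mfderiv 𝓘(ℝ, E) 𝓘(ℝ, E) e y

/-- A complex structure on the real smooth manifold `M`, given by its multiplication by `√-1` on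
the tangent bundle. The model `E` is a complex vector space (`E = ℂⁿ`), but the charts of `M` are
only smooth over `ℝ`. Integrability says that around each point there is a chart of the smooth
structure of `M`, with values in `E`, that is holomorphic, i.e. whose differential carries the
given endomorphism to multiplication by `√-1`; smoothness of the endomorphism field follows. -/
structure ComplexStructure (E : Type v) [NormedAddCommGroup E] [NormedSpace ℂ E]
    (M : Type u) [TopologicalSpace M] [ChartedSpace E M] where
  /-- the endomorphism `I` of the tangent bundle -/
  endo : ∀ x : M, TangentSpace 𝓘(ℝ, E) x →L[ℝ] TangentSpace 𝓘(ℝ, E) x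
  endo_endo : ∀ (x : M) (w : TangentSpace 𝓘(ℝ, E) x), endo x (endo x w) = -w
  integrable : ∀ x : M, ∃ e ∈ IsManifold.maximalAtlas 𝓘(ℝ, E) ∞ M, x ∈ e.source ∧
    ∀ y ∈ e.source, ∀ w : TangentSpace 𝓘(ℝ, E) y,
      chartDeriv e y (endo y w) = Complex.I • chartDeriv e y w

namespace ComplexStructure

variable {E : Type v} [NormedAddCommGroup E] [NormedSpace ℂ E]
  {M : Type u} [TopologicalSpace M] [ChartedSpace E M]

/-- The expression of the endomorphism field in the chart `chartAt E p` (meaningful on the open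
target of that chart): a function with values in the real endomorphisms of `E`. -/
def inChart (J : ComplexStructure E M) (p : M) (y : E) : E →L[ℝ] E :=
  (mfderiv 𝓘(ℝ, E) 𝓘(ℝ, E) (chartAt E p) ((chartAt E p).symm y)) ∘L
    (J.endo ((chartAt E p).symm y)) ∘L
      (mfderiv 𝓘(ℝ, E) 𝓘(ℝ, E) (chartAt E p).symm y)

/-- The `C^k` topology (`k ≤ ∞`) on the set of complex structures on `M`: uniform convergence of
the coordinate expressions, with all their derivatives of order `j ≤ k`, on the compact subsets of
the chart domains. -/
@[reducible]
def ckTopology (k : ℕ∞) : TopologicalSpace (ComplexStructure E M) :=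
  ⨅ (p : M) (j : ℕ) (_ : (j : ℕ∞) ≤ k),
    TopologicalSpace.induced
      (fun J : ComplexStructure E M =>
        UniformOnFun.ofFun {K : Set E | IsCompact K ∧ K ⊆ (chartAt E p).target}
          (iteratedFDeriv ℝ j (J.inChart p)))
      inferInstance

/-- The 1-form `dφ ∘ I`. -/
def dComp (J : ComplexStructure E M) (φ : M → ℝ) : DiffForm E M 1 := fun x =>
  ContinuousAlternatingMap.ofSubsingleton ℝ (TangentSpace 𝓘(ℝ, E) x) ℝ (0 : Fin 1)
    ((mfderiv 𝓘(ℝ, E) 𝓘(ℝ, ℝ) φ x : TangentSpace 𝓘(ℝ, E) x →L[ℝ] ℝ) ∘L J.endo x)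

/-- The real 2-form `-√-1 ∂∂̄φ`. As `∂̄φ = ½ (dφ + √-1 dφ ∘ I)` and `∂∂̄φ = d∂̄φ`, it is
`½ d(dφ ∘ I)`. -/
def negIDDbar (J : ComplexStructure E M) (φ : M → ℝ) : DiffForm E M 2 := fun x =>
  (1 / 2 : ℝ) • DiffForm.extDer (J.dComp φ) x

/-- `Ω` is a Kähler form on the complex manifold `(M, I)`: a smooth closed `I`-invariant real
2-form such that `g (X, X) = Ω (I X, X)` is positive definite. This is the sign convention
`Ω (X, Y) = g (X, I Y)`, for which `-√-1 ∂∂̄ |z|²` is a Kähler form on `ℂⁿ`. -/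
structure IsKahlerForm (J : ComplexStructure E M) (Ω : DiffForm E M 2) : Prop where
  smooth : DiffForm.IsSmooth Ω
  closed : ∀ x : M, DiffForm.extDer Ω x = 0
  invariant : ∀ (x : M) (a b : TangentSpace 𝓘(ℝ, E) x),
    Ω x ![J.endo x a, J.endo x b] = Ω x ![a, b]
  positive : ∀ (x : M) (a : TangentSpace 𝓘(ℝ, E) x), a ≠ 0 → 0 < Ω x ![J.endo x a, a]

variable {N : Type u} [TopologicalSpace N] [ChartedSpace E N]

/-- `π : N → M` is a connected Galois (regular) holomorphic covering, so that `M` is the quotient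
of `N` by the monodromy (deck transformation) group of `π`. -/
structure IsGaloisCovering (J' : ComplexStructure E N) (J : ComplexStructure E M)
    (π : N → M) : Prop where
  connected : ConnectedSpace N
  covering : IsCoveringMap π
  surjective : Function.Surjective π
  localDiffeo : IsLocalDiffeomorph 𝓘(ℝ, E) 𝓘(ℝ, E) ∞ π
  holomorphic : ∀ (x : N) (w : TangentSpace 𝓘(ℝ, E) x),
    mfderiv 𝓘(ℝ, E) 𝓘(ℝ, E) π x (J'.endo x w) =
      J.endo (π x) (mfderiv 𝓘(ℝ, E) 𝓘(ℝ, E) π x w)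
  regular : ∀ x y : N, π x = π y → ∃ γ : N ≃ₜ N, π ∘ γ = π ∧ γ x = y

/-- `φ : N → ℝ^{>0}` is an LCK potential for the Kähler form `Ω` on the covering `π : N → M`: it
is smooth and positive, proper as a map to `ℝ^{>0}`, multiplied by a constant by every deck
transformation of `π`, and a Kähler potential of `Ω`. -/
structure IsLCKPotential (J' : ComplexStructure E N) (π : N → M) (Ω : DiffForm E N 2)
    (φ : N → ℝ) : Prop where
  smooth : ContMDiff 𝓘(ℝ, E) 𝓘(ℝ, ℝ) ∞ φ
  pos : ∀ x, 0 < φ x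
  proper : ∀ K : Set ℝ, IsCompact K → K ⊆ Set.Ioi 0 → IsCompact (φ ⁻¹' K)
  automorphic : ∀ γ : N ≃ₜ N, π ∘ γ = π → ∃ c : ℝ, ∀ x, φ (γ x) = c * φ x
  potential : J'.negIDDbar φ = Ω

/-- The complex manifold `(M, I)` is an LCK manifold with potential: it has a Kähler covering
`(N, Ω)` carrying an LCK potential. -/
def IsLCKWithPotential (J : ComplexStructure E M) : Prop :=
  ∃ (N : Type u) (_ : TopologicalSpace N) (_ : ChartedSpace E N)
    (_ : IsManifold 𝓘(ℝ, E) ∞ N) (J' : ComplexStructure E N) (π : N → M)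
    (Ω : DiffForm E N 2) (φ : N → ℝ),
    IsGaloisCovering J' J π ∧ J'.IsKahlerForm Ω ∧ J'.IsLCKPotential π Ω φ

end ComplexStructure

end

/-!
Let `π : N → M` be the covering of an LCK manifold with potential `(M, I)`, and `φ` its potential.
For a complex structure `I'` near `I` the covering and the function `φ` are kept: `N` receives the
complex structure lifted from `I'` (`ComplexStructure.pullback`), and the new Kähler form is
`-√-1 ∂∂̄φ = ½ d(dφ ∘ I')`. Properness, positivity and automorphy of `φ` do not involve the complex
structure, and the deck transformations are the same, so what has to be shown is that the new form
is Kähler.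

The form is smooth and exact, because exterior derivatives can be computed in every chart
(`DiffForm.inCoord_extDer`, from the naturality of `extDeriv` under pullback). It is `I'`-invariant,
because in a holomorphic chart its value on `(a, b)` is half of `H a (√-1 b) - H b (√-1 a)` with a
symmetric `H` (`ComplexStructure.negIDDbar_invariant`).

It remains to see that it is positive. In a chart of `M` lifted to `N`, its values are a polynomial
expression `leviValue` in the first two derivatives of `φ` and in the value and the first derivative
of the expression of `I'`. Hence positivity on a compact part of the chart is a `C¹`-open condition
on `I'` (`exists_forall_leviValue_pos`). Deck transformations multiply `φ` by positive constants, so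
positivity at one point of a fibre of `π` is equivalent to positivity on the whole fibre
(`ComplexStructure.negIDDbar_pos_of_same_fibre`). By compactness of `M`, finitely many compact parts
of charts suffice.
-/

noncomputable section

open Filter Set

/-! ### Differential forms in charts -/

section FormsInCharts

lemma OpenPartialHomeomorph.eventually_symm_mem_source {X Y Z : Type*} [TopologicalSpace X]
    [TopologicalSpace Y] [TopologicalSpace Z] {e : OpenPartialHomeomorph X Y}
    {e' : OpenPartialHomeomorph X Z} {z : Y} (hz : z ∈ e.target) (hz' : e.symm z ∈ e'.source) :
    ∀ᶠ y in 𝓝 z, y ∈ e.target ∧ e.symm y ∈ e'.source :=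
  Filter.Eventually.and (e.open_target.mem_nhds hz)
    ((e.continuousAt_symm hz).eventually_mem (e'.open_source.mem_nhds hz'))

lemma minSmoothness_two_le_infty : minSmoothness ℝ 2 ≤ (∞ : WithTop ℕ∞) := by
  rw [minSmoothness_of_isRCLikeNormedField]
  exact WithTop.coe_le_coe.2 (le_top : (2 : ℕ∞) ≤ ⊤)

variable {E : Type v} [NormedAddCommGroup E] [NormedSpace ℝ E]
  {M : Type u} [TopologicalSpace M] [ChartedSpace E M] {e e' : OpenPartialHomeomorph M E}

lemma OpenPartialHomeomorph.mdifferentiable_of_mem_maximalAtlas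
    (he : e ∈ IsManifold.maximalAtlas 𝓘(ℝ, E) ∞ M) :
    e.MDifferentiable 𝓘(ℝ, E) 𝓘(ℝ, E) :=
  ⟨(contMDiffOn_of_mem_maximalAtlas he).mdifferentiableOn (by simp),
    (contMDiffOn_symm_of_mem_maximalAtlas he).mdifferentiableOn (by simp)⟩

lemma OpenPartialHomeomorph.contDiffAt_comp_symm
    (he : e ∈ IsManifold.maximalAtlas 𝓘(ℝ, E) ∞ M)
    (he' : e' ∈ IsManifold.maximalAtlas 𝓘(ℝ, E) ∞ M) {z : E} (hz : z ∈ e.target)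
    (hz' : e.symm z ∈ e'.source) : ContDiffAt ℝ ∞ (e' ∘ e.symm) z := by
  rw [← contMDiffAt_iff_contDiffAt]
  exact (contMDiffAt_of_mem_maximalAtlas he' hz').comp z
    (contMDiffAt_symm_of_mem_maximalAtlas he hz)

lemma OpenPartialHomeomorph.fderiv_comp_symm
    (he : e ∈ IsManifold.maximalAtlas 𝓘(ℝ, E) ∞ M)
    (he' : e' ∈ IsManifold.maximalAtlas 𝓘(ℝ, E) ∞ M) {z : E} (hz : z ∈ e.target)
    (hz' : e.symm z ∈ e'.source) :
    fderiv ℝ (e' ∘ e.symm) z =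
      (mfderiv 𝓘(ℝ, E) 𝓘(ℝ, E) e' (e.symm z)) ∘L (mfderiv 𝓘(ℝ, E) 𝓘(ℝ, E) e.symm z) := by
  rw [← mfderiv_eq_fderiv]
  exact mfderiv_comp z ((mdifferentiable_of_mem_maximalAtlas he').mdifferentiableAt hz')
    ((mdifferentiable_of_mem_maximalAtlas he).mdifferentiableAt_symm hz)

lemma OpenPartialHomeomorph.mfderiv_symm_mfderiv
    (he : e ∈ IsManifold.maximalAtlas 𝓘(ℝ, E) ∞ M) {x : M} (hx : x ∈ e.source)
    (w : TangentSpace 𝓘(ℝ, E) x) :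
    mfderiv 𝓘(ℝ, E) 𝓘(ℝ, E) e.symm (e x) (mfderiv 𝓘(ℝ, E) 𝓘(ℝ, E) e x w) = w :=
  congr($((mdifferentiable_of_mem_maximalAtlas he).symm_comp_deriv hx) w)

lemma OpenPartialHomeomorph.mfderiv_mfderiv_symm
    (he : e ∈ IsManifold.maximalAtlas 𝓘(ℝ, E) ∞ M) {z : E} (hz : z ∈ e.target) (w : E) :
    mfderiv 𝓘(ℝ, E) 𝓘(ℝ, E) e (e.symm z) (mfderiv 𝓘(ℝ, E) 𝓘(ℝ, E) e.symm z w) = w :=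
  congr($((mdifferentiable_of_mem_maximalAtlas he).comp_symm_deriv hz) w)

namespace DiffForm

/-- The expression of a form in an arbitrary chart `e`: its pullback under `e.symm`. It is
meaningful on `e.target`; for `e = chartAt E p` it is `DiffForm.inChart α p`. -/
def inCoord {k : ℕ} (α : DiffForm E M k) (e : OpenPartialHomeomorph M E) (z : E) :
    E [⋀^Fin k]→L[ℝ] ℝ :=
  (α (e.symm z)).compContinuousLinearMap (mfderiv 𝓘(ℝ, E) 𝓘(ℝ, E) e.symm z)

/-- Congruence for the value of a form at a varying point; the vectors are taken in the model space,
to which all tangent spaces are definitionally equal. -/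
lemma apply_congr {k : ℕ} (α : DiffForm E M k) {x y : M} (h : x = y) {v w : Fin k → E}
    (hvw : v = w) : (show ℝ from α x v) = α y w := by
  subst h hvw; rfl

/-- The expressions of a form in two charts differ by the pullback under the transition map. -/
lemma inCoord_eq_pullback {k : ℕ} (α : DiffForm E M k)
    (he : e ∈ IsManifold.maximalAtlas 𝓘(ℝ, E) ∞ M)
    (he' : e' ∈ IsManifold.maximalAtlas 𝓘(ℝ, E) ∞ M) {z : E} (hz : z ∈ e.target)
    (hz' : e.symm z ∈ e'.source) :
    inCoord α e z = (inCoord α e' ((e' ∘ e.symm) z)).compContinuousLinearMap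
      (fderiv ℝ (e' ∘ e.symm) z) := by
  ext v
  refine apply_congr α (e'.left_inv hz').symm (funext fun i => ?_)
  simp only [Function.comp_apply]
  rw [OpenPartialHomeomorph.fderiv_comp_symm he he' hz hz']
  exact (OpenPartialHomeomorph.mfderiv_symm_mfderiv he' hz' _).symm

/-- The exterior derivative of the coordinate expressions is compatible with changes of charts. -/
lemma extDeriv_inCoord_eq_pullback {k : ℕ} (α : DiffForm E M k)
    (he : e ∈ IsManifold.maximalAtlas 𝓘(ℝ, E) ∞ M)
    (he' : e' ∈ IsManifold.maximalAtlas 𝓘(ℝ, E) ∞ M) {z : E} (hz : z ∈ e.target)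
    (hz' : e.symm z ∈ e'.source)
    (hα : DifferentiableAt ℝ (inCoord α e') (e' (e.symm z))) :
    extDeriv (inCoord α e) z = (extDeriv (inCoord α e') (e' (e.symm z))).compContinuousLinearMap
      (fderiv ℝ (e' ∘ e.symm) z) := by
  have h : inCoord α e =ᶠ[𝓝 z] fun y => (inCoord α e' ((e' ∘ e.symm) y)).compContinuousLinearMap
      (fderiv ℝ (e' ∘ e.symm) y) := by
    filter_upwards [OpenPartialHomeomorph.eventually_symm_mem_source hz hz'] with y hy
    exact inCoord_eq_pullback α he he' hy.1 hy.2
  rw [h.extDeriv_eq]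
  exact extDeriv_pullback (r := ∞) hα (OpenPartialHomeomorph.contDiffAt_comp_symm he he' hz hz')
    minSmoothness_two_le_infty

/-- The value of a form at a point, recovered from its expression in a chart. -/
lemma apply_eq_inCoord {k : ℕ} (α : DiffForm E M k)
    (he : e ∈ IsManifold.maximalAtlas 𝓘(ℝ, E) ∞ M) {x : M} (hx : x ∈ e.source)
    (w : Fin k → TangentSpace 𝓘(ℝ, E) x) :
    α x w = inCoord α e (e x)
      (fun i => (mfderiv 𝓘(ℝ, E) 𝓘(ℝ, E) e x (w i) : TangentSpace 𝓘(ℝ, E) (e x))) :=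
  apply_congr α (e.left_inv hx).symm
    (funext fun i => (OpenPartialHomeomorph.mfderiv_symm_mfderiv he hx (w i)).symm)

lemma IsSmooth.differentiableAt_inChart {k : ℕ} {α : DiffForm E M k} (hα : IsSmooth α) (x : M) :
    DifferentiableAt ℝ (inChart α x) (chartAt E x x) :=
  ((hα x).contDiffAt ((chartAt E x).open_target.mem_nhds (mem_chart_target E x))).differentiableAt
    (by simp)

variable [IsManifold 𝓘(ℝ, E) ∞ M]

/-- The exterior derivative can be computed in every chart. -/
lemma inCoord_extDer {k : ℕ} (α : DiffForm E M k)
    (he : e ∈ IsManifold.maximalAtlas 𝓘(ℝ, E) ∞ M) {z : E} (hz : z ∈ e.target)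
    (hα : IsSmooth α) :
    inCoord (extDer α) e z = extDeriv (inCoord α e) z := by
  have hs := mem_chart_source E (e.symm z)
  have hc := IsManifold.chart_mem_maximalAtlas (I := 𝓘(ℝ, E)) (n := ∞) (e.symm z)
  rw [extDeriv_inCoord_eq_pullback α he hc hz hs (hα.differentiableAt_inChart _),
    OpenPartialHomeomorph.fderiv_comp_symm he hc hz hs]
  rfl

lemma extDer_extDer {k : ℕ} (α : DiffForm E M k) (hα : IsSmooth α) (x : M) :
    extDer (extDer α) x = 0 := by
  have hc := IsManifold.chart_mem_maximalAtlas (I := 𝓘(ℝ, E)) (n := ∞) x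
  have hx := mem_chart_target E x
  have h : inChart (extDer α) x =ᶠ[𝓝 (chartAt E x x)] extDeriv (inChart α x) := by
    filter_upwards [(chartAt E x).open_target.mem_nhds hx] with z hz
    exact inCoord_extDer α hc hz hα
  have h0 : extDeriv (inChart (extDer α) x) (chartAt E x x) = 0 := by
    rw [h.extDeriv_eq]
    exact extDeriv_extDeriv_apply
      ((hα x).contDiffAt ((chartAt E x).open_target.mem_nhds hx))
      minSmoothness_two_le_infty
  rw [extDer, h0]
  rfl

lemma IsSmooth.extDer {k : ℕ} {α : DiffForm E M k} (hα : IsSmooth α) :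
    IsSmooth (DiffForm.extDer α) := by
  intro p
  have h : ContDiffOn ℝ ∞ (extDeriv (inChart α p)) (chartAt E p).target :=
    (ContinuousAlternatingMap.alternatizeUncurryFinCLM ℝ E ℝ).contDiff.comp_contDiffOn
      ((hα p).fderiv_of_isOpen (chartAt E p).open_target (by simp))
  exact h.congr fun z hz => inCoord_extDer α
    (IsManifold.chart_mem_maximalAtlas (I := 𝓘(ℝ, E)) (n := ∞) p) hz hα

end DiffForm

end FormsInCharts

/-! ### Complex structures and `-√-1 ∂∂̄φ` in charts -/

section Levi

variable {E : Type*} [NormedAddCommGroup E] [NormedSpace ℝ E]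

/-- The value on `(a, b)` of `d (dψ ∘ B)` at a point, as a function of the first and second
derivatives `L`, `H` of `ψ` and of the value `B` and the derivative `B'` of the endomorphism field
at this point. -/
def leviValue (L : E →L[ℝ] ℝ) (H : E →L[ℝ] E →L[ℝ] ℝ) (B : E →L[ℝ] E) (B' : E →L[ℝ] E →L[ℝ] E)
    (a b : E) : ℝ :=
  H a (B b) + L (B' a b) - (H b (B a) + L (B' b a))

/-- `d (dψ ∘ B)` at a point, by the product rule. -/
lemma extDeriv_ofSubsingleton_fderiv_comp {ψ : E → ℝ} {B : E → E →L[ℝ] E} {z : E}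
    (hψ : DifferentiableAt ℝ (fderiv ℝ ψ) z) (hB : DifferentiableAt ℝ B z) (v : Fin 2 → E) :
    extDeriv (fun y => ContinuousAlternatingMap.ofSubsingleton ℝ E ℝ (0 : Fin 1)
      (fderiv ℝ ψ y ∘L B y)) z v =
      leviValue (fderiv ℝ ψ z) (fderiv ℝ (fderiv ℝ ψ) z) (B z) (fderiv ℝ B z) (v 0) (v 1) := by
  have hd : DifferentiableAt ℝ (fun y => ContinuousAlternatingMap.ofSubsingleton ℝ E ℝ (0 : Fin 1)
      (fderiv ℝ ψ y ∘L B y)) z :=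
    (ContinuousAlternatingMap.ofSubsingletonLIE (𝕜 := ℝ) (E := E) (F := ℝ)
      (0 : Fin 1)).differentiableAt.comp z (hψ.clm_comp hB)
  have key : ∀ a b : E, fderiv ℝ (fun y => fderiv ℝ ψ y (B y b)) z a =
      fderiv ℝ (fderiv ℝ ψ) z a (B z b) + fderiv ℝ ψ z (fderiv ℝ B z a b) := by
    intro a b
    have h1 : HasFDerivAt (fun y => B y b) ((fderiv ℝ B z).flip b) z := by
      simpa using hB.hasFDerivAt.clm_apply (hasFDerivAt_const b z)
    rw [(hψ.hasFDerivAt.clm_apply h1).fderiv]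
    simp [add_comm]
  rw [extDeriv_apply hd, Fin.sum_univ_two]
  simp only [leviValue, Fin.removeNth, ContinuousAlternatingMap.ofSubsingleton_apply_apply,
    ContinuousLinearMap.comp_apply, key]
  simp only [Fin.val_zero, pow_zero, one_smul, Fin.val_one, pow_one, neg_one_smul]
  exact (sub_eq_add_neg _ _).symm

end Levi

namespace ComplexStructure

variable {E : Type v} [NormedAddCommGroup E] [NormedSpace ℂ E]
  {M : Type u} [TopologicalSpace M] [ChartedSpace E M] {e e' : OpenPartialHomeomorph M E}

/-- The expression of the endomorphism field in an arbitrary chart `e`, meaningful on `e.target`;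
for `e = chartAt E p` it is `ComplexStructure.inChart J p`. -/
def inCoord (J : ComplexStructure E M) (e : OpenPartialHomeomorph M E) (z : E) : E →L[ℝ] E :=
  (mfderiv 𝓘(ℝ, E) 𝓘(ℝ, E) e (e.symm z)) ∘L (J.endo (e.symm z)) ∘L
    (mfderiv 𝓘(ℝ, E) 𝓘(ℝ, E) e.symm z)

/-- The expression of the endomorphism field in the chart `e` is the endomorphism `B` as soon as
the differential of `e` intertwines the two. -/
lemma inCoord_eq_of_forall (J : ComplexStructure E M)
    (he : e ∈ IsManifold.maximalAtlas 𝓘(ℝ, E) ∞ M) {z : E} (hz : z ∈ e.target) (B : E →L[ℝ] E)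
    (h : ∀ w : TangentSpace 𝓘(ℝ, E) (e.symm z), chartDeriv e (e.symm z) (J.endo (e.symm z) w) =
      B (chartDeriv e (e.symm z) w)) : J.inCoord e z = B := by
  ext w
  refine (h _).trans ?_
  exact congrArg B (OpenPartialHomeomorph.mfderiv_mfderiv_symm he hz w)

/-- Variant of `chartDeriv_endo` in which the point of `M` and its coordinate `z` are independent
variables, so that rewriting `z` does not affect the type of the tangent vector. -/
lemma chartDeriv_endo_symm (J : ComplexStructure E M)
    (he : e ∈ IsManifold.maximalAtlas 𝓘(ℝ, E) ∞ M) {x : M} (hx : x ∈ e.source)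
    {z : E} (hxz : e.symm z = x) (hz : z ∈ e.target) (w : TangentSpace 𝓘(ℝ, E) x) :
    chartDeriv e x (J.endo x w) = J.inCoord e z (chartDeriv e x w) := by
  subst hxz
  have h := OpenPartialHomeomorph.mfderiv_symm_mfderiv he hx w
  rw [e.right_inv hz] at h
  exact congrArg (fun u => chartDeriv e (e.symm z) (J.endo (e.symm z) u)) h.symm

lemma chartDeriv_endo (J : ComplexStructure E M)
    (he : e ∈ IsManifold.maximalAtlas 𝓘(ℝ, E) ∞ M) {x : M} (hx : x ∈ e.source)
    (w : TangentSpace 𝓘(ℝ, E) x) :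
    chartDeriv e x (J.endo x w) = J.inCoord e (e x) (chartDeriv e x w) :=
  J.chartDeriv_endo_symm he hx (e.left_inv hx) (e.map_source hx) w

/-- The expressions of the endomorphism field in two charts are conjugate by the derivative of the
transition map. -/
lemma inCoord_eq_conj (J : ComplexStructure E M)
    (he : e ∈ IsManifold.maximalAtlas 𝓘(ℝ, E) ∞ M)
    (he' : e' ∈ IsManifold.maximalAtlas 𝓘(ℝ, E) ∞ M) {z : E} (hz : z ∈ e.target)
    (hz' : e.symm z ∈ e'.source) :
    J.inCoord e z = fderiv ℝ (e ∘ e'.symm) ((e' ∘ e.symm) z) ∘L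
      J.inCoord e' ((e' ∘ e.symm) z) ∘L fderiv ℝ (e' ∘ e.symm) z := by
  have hl := e'.left_inv hz'
  have h2 : e'.symm (e' (e.symm z)) ∈ e.source := by rw [hl]; exact e.map_target hz
  rw [Function.comp_apply, OpenPartialHomeomorph.fderiv_comp_symm he he' hz hz',
    OpenPartialHomeomorph.fderiv_comp_symm he' he (e'.map_source hz') h2]
  ext w
  have h3 := J.chartDeriv_endo he' hz' (mfderiv 𝓘(ℝ, E) 𝓘(ℝ, E) e.symm z w)
  refine Eq.trans ?_ (congrArg (fun u => (mfderiv 𝓘(ℝ, E) 𝓘(ℝ, E) e (e'.symm (e' (e.symm z))))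
    ((mfderiv 𝓘(ℝ, E) 𝓘(ℝ, E) e'.symm (e' (e.symm z))) u)) h3)
  have h4 := OpenPartialHomeomorph.mfderiv_symm_mfderiv he' hz'
    (J.endo (e.symm z) (mfderiv 𝓘(ℝ, E) 𝓘(ℝ, E) e.symm z w))
  refine Eq.trans ?_ (congrArg (mfderiv 𝓘(ℝ, E) 𝓘(ℝ, E) e (e'.symm (e' (e.symm z)))) h4.symm)
  rw [hl]
  rfl

/-- In a holomorphic chart the endomorphism field is multiplication by `√-1`. -/
lemma inCoord_eq_I (J : ComplexStructure E M)
    (he : e ∈ IsManifold.maximalAtlas 𝓘(ℝ, E) ∞ M)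
    (hJ : ∀ y ∈ e.source, ∀ w : TangentSpace 𝓘(ℝ, E) y,
      chartDeriv e y (J.endo y w) = Complex.I • chartDeriv e y w) {z : E} (hz : z ∈ e.target) :
    J.inCoord e z = Complex.I • ContinuousLinearMap.id ℝ E :=
  J.inCoord_eq_of_forall he hz _ fun w => hJ _ (e.map_target hz) w

/-- The endomorphism field is smooth: it is constant in holomorphic charts. -/
lemma contDiffAt_inCoord (J : ComplexStructure E M)
    (he : e ∈ IsManifold.maximalAtlas 𝓘(ℝ, E) ∞ M) {z : E} (hz : z ∈ e.target) :
    ContDiffAt ℝ ∞ (J.inCoord e) z := by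
  obtain ⟨h, hh, hzh, hJ⟩ := J.integrable (e.symm z)
  have ht := OpenPartialHomeomorph.contDiffAt_comp_symm he hh hz hzh
  have ht' : ContDiffAt ℝ ∞ (e ∘ h.symm) ((h ∘ e.symm) z) :=
    OpenPartialHomeomorph.contDiffAt_comp_symm hh he (h.map_source hzh)
      (by rw [Function.comp_apply, h.left_inv hzh]; exact e.map_target hz)
  have key : ContDiffAt ℝ ∞ (fun y => fderiv ℝ (e ∘ h.symm) ((h ∘ e.symm) y) ∘L
      (Complex.I • ContinuousLinearMap.id ℝ E) ∘L fderiv ℝ (h ∘ e.symm) y) z :=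
    ((ht'.fderiv_right (m := ∞) (by simp)).comp z ht).clm_comp
      (contDiffAt_const.clm_comp (ht.fderiv_right (m := ∞) (by simp)))
  refine key.congr_of_eventuallyEq ?_
  filter_upwards [OpenPartialHomeomorph.eventually_symm_mem_source hz hzh] with y hy
  rw [J.inCoord_eq_conj he hh hy.1 hy.2,
    J.inCoord_eq_I hh hJ (z := (h ∘ e.symm) y) (h.map_source hy.2)]

/-- The form `dφ ∘ I` in an arbitrary chart. -/
lemma inCoord_dComp (J : ComplexStructure E M) {φ : M → ℝ}
    (hφ : ContMDiff 𝓘(ℝ, E) 𝓘(ℝ, ℝ) ∞ φ)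
    (he : e ∈ IsManifold.maximalAtlas 𝓘(ℝ, E) ∞ M) {z : E} (hz : z ∈ e.target) :
    DiffForm.inCoord (J.dComp φ) e z = ContinuousAlternatingMap.ofSubsingleton ℝ E ℝ (0 : Fin 1)
      (fderiv ℝ (φ ∘ e.symm) z ∘L J.inCoord e z) := by
  have hf : fderiv ℝ (φ ∘ e.symm) z = (mfderiv 𝓘(ℝ, E) 𝓘(ℝ, ℝ) φ (e.symm z)) ∘L
      (mfderiv 𝓘(ℝ, E) 𝓘(ℝ, E) e.symm z) := by
    rw [← mfderiv_eq_fderiv]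
    exact mfderiv_comp z (hφ.mdifferentiableAt (by simp))
      ((OpenPartialHomeomorph.mdifferentiable_of_mem_maximalAtlas he).mdifferentiableAt_symm hz)
  have hs := e.map_target hz
  rw [hf]
  ext v
  have h := OpenPartialHomeomorph.mfderiv_symm_mfderiv he hs
    (J.endo (e.symm z) (mfderiv 𝓘(ℝ, E) 𝓘(ℝ, E) e.symm z (v 0)))
  rw [e.right_inv hz] at h
  exact congrArg (mfderiv 𝓘(ℝ, E) 𝓘(ℝ, ℝ) φ (e.symm z)) h.symm

lemma contDiffAt_comp_symm {φ : M → ℝ} (hφ : ContMDiff 𝓘(ℝ, E) 𝓘(ℝ, ℝ) ∞ φ)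
    (he : e ∈ IsManifold.maximalAtlas 𝓘(ℝ, E) ∞ M) {z : E} (hz : z ∈ e.target) :
    ContDiffAt ℝ ∞ (φ ∘ e.symm) z := by
  rw [← contMDiffAt_iff_contDiffAt]
  exact hφ.contMDiffAt.comp z (contMDiffAt_symm_of_mem_maximalAtlas he hz)

variable [IsManifold 𝓘(ℝ, E) ∞ M]

lemma isSmooth_dComp (J : ComplexStructure E M) {φ : M → ℝ}
    (hφ : ContMDiff 𝓘(ℝ, E) 𝓘(ℝ, ℝ) ∞ φ) : DiffForm.IsSmooth (J.dComp φ) := by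
  intro p z hz
  have hc := IsManifold.chart_mem_maximalAtlas (I := 𝓘(ℝ, E)) (n := ∞) p
  have key : ContDiffAt ℝ ∞ (fun y => ContinuousAlternatingMap.ofSubsingleton ℝ E ℝ (0 : Fin 1)
      (fderiv ℝ (φ ∘ (chartAt E p).symm) y ∘L J.inCoord (chartAt E p) y)) z :=
    (ContinuousAlternatingMap.ofSubsingletonLIE (𝕜 := ℝ) (E := E) (F := ℝ)
      (0 : Fin 1)).contDiff.contDiffAt.comp z
      (((contDiffAt_comp_symm hφ hc hz).fderiv_right (m := ∞) (by simp)).clm_comp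
        (J.contDiffAt_inCoord hc hz))
  refine (key.congr_of_eventuallyEq ?_).contDiffWithinAt
  filter_upwards [(chartAt E p).open_target.mem_nhds hz] with y hy
  exact J.inCoord_dComp hφ hc hy

/-- The form `-√-1 ∂∂̄φ` in an arbitrary chart. -/
lemma negIDDbar_apply (J : ComplexStructure E M) {φ : M → ℝ}
    (hφ : ContMDiff 𝓘(ℝ, E) 𝓘(ℝ, ℝ) ∞ φ)
    (he : e ∈ IsManifold.maximalAtlas 𝓘(ℝ, E) ∞ M) {x : M} (hx : x ∈ e.source)
    (a b : TangentSpace 𝓘(ℝ, E) x) :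
    J.negIDDbar φ x ![a, b] = 1 / 2 * leviValue (fderiv ℝ (φ ∘ e.symm) (e x))
      (fderiv ℝ (fderiv ℝ (φ ∘ e.symm)) (e x)) (J.inCoord e (e x))
      (fderiv ℝ (J.inCoord e) (e x)) (chartDeriv e x a) (chartDeriv e x b) := by
  have hz := e.map_source hx
  have h1 : DiffForm.extDer (J.dComp φ) x ![a, b] =
      extDeriv (DiffForm.inCoord (J.dComp φ) e) (e x) ![chartDeriv e x a, chartDeriv e x b] := by
    rw [DiffForm.apply_eq_inCoord _ he hx, DiffForm.inCoord_extDer _ he hz (J.isSmooth_dComp hφ)]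
    congr 1
    ext i
    fin_cases i <;> rfl
  have h2 : DiffForm.inCoord (J.dComp φ) e =ᶠ[𝓝 (e x)] fun y =>
      ContinuousAlternatingMap.ofSubsingleton ℝ E ℝ (0 : Fin 1)
        (fderiv ℝ (φ ∘ e.symm) y ∘L J.inCoord e y) := by
    filter_upwards [e.open_target.mem_nhds hz] with y hy
    exact J.inCoord_dComp hφ he hy
  have h3 := extDeriv_ofSubsingleton_fderiv_comp
    (((contDiffAt_comp_symm hφ he hz).fderiv_right (m := ∞) (by simp)).differentiableAt (by simp))
    ((J.contDiffAt_inCoord he hz).differentiableAt (by simp))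
    ![chartDeriv e x a, chartDeriv e x b]
  rw [← h2.extDeriv_eq, ← h1] at h3
  exact congrArg (fun t => 1 / 2 * t) h3

end ComplexStructure

/-! ### The Kähler property and coverings -/

namespace DiffForm

variable {E : Type v} [NormedAddCommGroup E] [NormedSpace ℝ E]
  {M : Type u} [TopologicalSpace M] [ChartedSpace E M]

lemma inChart_const_smul {k : ℕ} (c : ℝ) (α : DiffForm E M k) (p : M) :
    inChart (fun x => c • α x) p = c • inChart α p := rfl

lemma IsSmooth.const_smul {k : ℕ} {α : DiffForm E M k} (hα : IsSmooth α) (c : ℝ) :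
    IsSmooth (fun x => c • α x) := fun p => (hα p).const_smul c

lemma extDer_const_smul {k : ℕ} (c : ℝ) (α : DiffForm E M k) (x : M) :
    extDer (fun x => c • α x) x = c • extDer α x := by
  rw [extDer, inChart_const_smul, extDeriv_smul]
  rfl

end DiffForm

namespace ComplexStructure

variable {E : Type v} [NormedAddCommGroup E] [NormedSpace ℂ E]
  {M : Type u} [TopologicalSpace M] [ChartedSpace E M]

/-- `-√-1 ∂∂̄φ` is `I`-invariant. In a holomorphic chart this is the symmetry of the second
derivative. -/
lemma negIDDbar_invariant [IsManifold 𝓘(ℝ, E) ∞ M] (J : ComplexStructure E M) {φ : M → ℝ}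
    (hφ : ContMDiff 𝓘(ℝ, E) 𝓘(ℝ, ℝ) ∞ φ) (x : M) (a b : TangentSpace 𝓘(ℝ, E) x) :
    J.negIDDbar φ x ![J.endo x a, J.endo x b] = J.negIDDbar φ x ![a, b] := by
  obtain ⟨e, he, hx, hJ⟩ := J.integrable x
  have hz := e.map_source hx
  have hB : J.inCoord e =ᶠ[𝓝 (e x)] fun _ => Complex.I • ContinuousLinearMap.id ℝ E := by
    filter_upwards [e.open_target.mem_nhds hz] with y hy using J.inCoord_eq_I he hJ hy
  have hsymm : IsSymmSndFDerivAt ℝ (φ ∘ e.symm) (e x) :=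
    (contDiffAt_comp_symm hφ he hz).isSymmSndFDerivAt minSmoothness_two_le_infty
  have hI : ∀ w : E, Complex.I • Complex.I • w = -w := fun w => by
    rw [smul_smul, Complex.I_mul_I, neg_one_smul]
  rw [J.negIDDbar_apply hφ he hx, J.negIDDbar_apply hφ he hx, hB.fderiv_eq, hB.self_of_nhds,
    hJ x hx a, hJ x hx b]
  simp only [leviValue, fderiv_fun_const, Pi.zero_apply, _root_.zero_apply, map_zero,
    add_zero, _root_.smul_apply, ContinuousLinearMap.id_apply, hI, map_neg]
  rw [hsymm (Complex.I • chartDeriv e x a), hsymm (Complex.I • chartDeriv e x b)]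
  ring

/-- A form `-√-1 ∂∂̄φ` is Kähler as soon as it is positive. -/
lemma isKahlerForm_negIDDbar [IsManifold 𝓘(ℝ, E) ∞ M] (J : ComplexStructure E M) {φ : M → ℝ}
    (hφ : ContMDiff 𝓘(ℝ, E) 𝓘(ℝ, ℝ) ∞ φ)
    (hpos : ∀ (x : M) (a : TangentSpace 𝓘(ℝ, E) x), a ≠ 0 →
      0 < J.negIDDbar φ x ![J.endo x a, a]) : J.IsKahlerForm (J.negIDDbar φ) where
  smooth := (J.isSmooth_dComp hφ).extDer.const_smul _
  closed x := by
    refine (DiffForm.extDer_const_smul _ _ x).trans ?_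
    rw [DiffForm.extDer_extDer _ (J.isSmooth_dComp hφ), smul_zero]
  invariant := J.negIDDbar_invariant hφ
  positive := hpos

variable {N : Type u} [TopologicalSpace N] [ChartedSpace E N] {π : N → M}

/-- A chart of `M` lifts, near every point over its domain, to a chart of `N`. -/
lemma exists_lift_chart [IsManifold 𝓘(ℝ, E) ∞ N]
    (hπ : IsLocalDiffeomorph 𝓘(ℝ, E) 𝓘(ℝ, E) ∞ π)
    {c : OpenPartialHomeomorph M E} (hc : c ∈ IsManifold.maximalAtlas 𝓘(ℝ, E) ∞ M) {x : N}
    (hx : π x ∈ c.source) :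
    ∃ e ∈ IsManifold.maximalAtlas 𝓘(ℝ, E) ∞ N, x ∈ e.source ∧
      ∀ y ∈ e.source, π y ∈ c.source ∧ e y = c (π y) := by
  obtain ⟨Φ, hxΦ, hΦ⟩ := hπ x
  have hsub : (Φ.toOpenPartialHomeomorph ≫ₕ c).source = Φ.source ∩ Φ.toPartialEquiv ⁻¹' c.source :=
    OpenPartialHomeomorph.trans_source _ _
  refine ⟨Φ.toOpenPartialHomeomorph ≫ₕ c, ?_, ?_, ?_⟩
  · refine OpenPartialHomeomorph.mem_maximalAtlas_of_contMDiffOn _ ?_ ?_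
    · refine (contMDiffOn_of_mem_maximalAtlas hc).comp
        (Φ.contMDiffOn_toFun.mono ?_) ?_
      · rw [hsub]; exact inter_subset_left
      · rw [hsub]; exact inter_subset_right
    · refine Φ.contMDiffOn_invFun.comp
        ((contMDiffOn_symm_of_mem_maximalAtlas hc).mono ?_) ?_
      · rw [OpenPartialHomeomorph.trans_target]; exact inter_subset_left
      · rw [OpenPartialHomeomorph.trans_target]; exact inter_subset_right
  · rw [hsub]
    exact ⟨hxΦ, by rw [mem_preimage, ← hΦ hxΦ]; exact hx⟩
  · intro y hy
    rw [hsub] at hy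
    have h := hΦ hy.1
    refine ⟨?_, ?_⟩
    · rw [h]; exact hy.2
    · rw [h]; rfl

lemma chartDeriv_lift_chart (hπ : IsLocalDiffeomorph 𝓘(ℝ, E) 𝓘(ℝ, E) ∞ π)
    {c : OpenPartialHomeomorph M E} (hc : c ∈ IsManifold.maximalAtlas 𝓘(ℝ, E) ∞ M)
    {e : OpenPartialHomeomorph N E} (hec : ∀ y ∈ e.source, π y ∈ c.source ∧ e y = c (π y)) {y : N}
    (hy : y ∈ e.source) (w : TangentSpace 𝓘(ℝ, E) y) :
    chartDeriv e y w = chartDeriv c (π y) (mfderiv 𝓘(ℝ, E) 𝓘(ℝ, E) π y w) := by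
  have h : (e : N → E) =ᶠ[𝓝 y] c ∘ π := by
    filter_upwards [e.open_source.mem_nhds hy] with y' hy' using (hec y' hy').2
  have h2 := h.mfderiv_eq (I := 𝓘(ℝ, E)) (I' := 𝓘(ℝ, E))
  rw [mfderiv_comp y
    ((OpenPartialHomeomorph.mdifferentiable_of_mem_maximalAtlas hc).mdifferentiableAt
      (hec y hy).1) (hπ.mdifferentiable (by simp) y)] at h2
  exact congr($h2 w)

/-- The complex structure on `N` that makes the local diffeomorphism `π : N → M` holomorphic. -/
def pullback [IsManifold 𝓘(ℝ, E) ∞ N]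
    (hπ : IsLocalDiffeomorph 𝓘(ℝ, E) 𝓘(ℝ, E) ∞ π) (J : ComplexStructure E M) :
    ComplexStructure E N where
  endo x := ((hπ.mfderivToContinuousLinearEquiv (by simp) x).symm : _ →L[ℝ] _) ∘L J.endo (π x) ∘L
    mfderiv 𝓘(ℝ, E) 𝓘(ℝ, E) π x
  endo_endo x w := by
    have h : ∀ u, mfderiv 𝓘(ℝ, E) 𝓘(ℝ, E) π x
        ((hπ.mfderivToContinuousLinearEquiv (by simp) x).symm u) = u := fun u =>
      (hπ.mfderivToContinuousLinearEquiv (by simp) x).apply_symm_apply u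
    simp only [ContinuousLinearMap.comp_apply, ContinuousLinearEquiv.coe_coe, h, J.endo_endo]
    rw [map_neg]
    exact congrArg Neg.neg ((hπ.mfderivToContinuousLinearEquiv (by simp) x).symm_apply_apply w)
  integrable x := by
    obtain ⟨c, hc, hx, hJ⟩ := J.integrable (π x)
    obtain ⟨e, he, hxe, hec⟩ := exists_lift_chart hπ hc hx
    refine ⟨e, he, hxe, fun y hy w => ?_⟩
    rw [chartDeriv_lift_chart hπ hc hec hy, chartDeriv_lift_chart hπ hc hec hy,
      ← hJ _ (hec y hy).1]
    exact congrArg (chartDeriv c (π y))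
      ((hπ.mfderivToContinuousLinearEquiv (by simp) y).apply_symm_apply _)

lemma mfderiv_pullback_endo [IsManifold 𝓘(ℝ, E) ∞ N]
    (hπ : IsLocalDiffeomorph 𝓘(ℝ, E) 𝓘(ℝ, E) ∞ π)
    (J : ComplexStructure E M) (x : N) (w : TangentSpace 𝓘(ℝ, E) x) :
    mfderiv 𝓘(ℝ, E) 𝓘(ℝ, E) π x ((J.pullback hπ).endo x w) =
      J.endo (π x) (mfderiv 𝓘(ℝ, E) 𝓘(ℝ, E) π x w) :=
  (hπ.mfderivToContinuousLinearEquiv (by simp) x).apply_symm_apply _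

/-- A Galois covering stays one, with the lifted structure, when the structure of the base changes:
only holomorphy involves the complex structures. -/
lemma IsGaloisCovering.pullback [IsManifold 𝓘(ℝ, E) ∞ N]
    {J₀ : ComplexStructure E N} {J : ComplexStructure E M}
    (h : J₀.IsGaloisCovering J π) (J' : ComplexStructure E M) :
    (J'.pullback h.localDiffeo).IsGaloisCovering J' π where
  connected := h.connected
  covering := h.covering
  surjective := h.surjective
  localDiffeo := h.localDiffeo
  holomorphic := J'.mfderiv_pullback_endo h.localDiffeo
  regular := h.regular

/-- A holomorphic local diffeomorphism identifies the expressions of the two complex structures in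
a chart and its lift. -/
lemma IsGaloisCovering.inCoord_lift_chart {J' : ComplexStructure E N} {J : ComplexStructure E M}
    (h : J'.IsGaloisCovering J π)
    {c : OpenPartialHomeomorph M E} (hc : c ∈ IsManifold.maximalAtlas 𝓘(ℝ, E) ∞ M)
    {e : OpenPartialHomeomorph N E} (he : e ∈ IsManifold.maximalAtlas 𝓘(ℝ, E) ∞ N)
    (hec : ∀ y ∈ e.source, π y ∈ c.source ∧ e y = c (π y)) {z : E} (hz : z ∈ e.target) :
    J'.inCoord e z = J.inCoord c z := by
  have hs := e.map_target hz
  obtain ⟨h1, h2⟩ := hec _ hs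
  rw [e.right_inv hz] at h2
  have h3 : c.symm z = π (e.symm z) := (congrArg c.symm h2).trans (c.left_inv h1)
  refine J'.inCoord_eq_of_forall he hz _ fun w => ?_
  rw [chartDeriv_lift_chart h.localDiffeo hc hec hs, chartDeriv_lift_chart h.localDiffeo hc hec hs,
    h.holomorphic]
  exact J.chartDeriv_endo_symm hc h1 h3 (by rw [h2]; exact c.map_source h1) _

end ComplexStructure

/-! ### Stability of positivity -/

section Levi

variable {E : Type v} [NormedAddCommGroup E] [NormedSpace ℝ E]

lemma leviValue_smul_smul (L : E →L[ℝ] ℝ) (H : E →L[ℝ] E →L[ℝ] ℝ) (B : E →L[ℝ] E)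
    (B' : E →L[ℝ] E →L[ℝ] E) (r : ℝ) (a b : E) :
    leviValue L H B B' (r • a) (r • b) = r * r * leviValue L H B B' a b := by
  simp only [leviValue, map_smul, _root_.smul_apply, smul_eq_mul]
  ring

/-- Multiplying `ψ` by a constant multiplies the value of `d (dψ ∘ B)` by it. -/
lemma smul_leviValue (c : ℝ) (L : E →L[ℝ] ℝ) (H : E →L[ℝ] E →L[ℝ] ℝ) (B : E →L[ℝ] E)
    (B' : E →L[ℝ] E →L[ℝ] E) (a b : E) :
    leviValue (c • L) (c • H) B B' a b = c * leviValue L H B B' a b := by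
  simp only [leviValue, _root_.smul_apply, smul_eq_mul]
  ring

lemma ContinuousAt.leviValue {X : Type*} [TopologicalSpace X] {x : X} {L : X → E →L[ℝ] ℝ}
    {H : X → E →L[ℝ] E →L[ℝ] ℝ} {B : X → E →L[ℝ] E} {B' : X → E →L[ℝ] E →L[ℝ] E} {a b : X → E}
    (hL : ContinuousAt L x) (hH : ContinuousAt H x) (hB : ContinuousAt B x)
    (hB' : ContinuousAt B' x) (ha : ContinuousAt a x) (hb : ContinuousAt b x) :
    ContinuousAt (fun y => leviValue (L y) (H y) (B y) (B' y) (a y) (b y)) x :=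
  (((hH.clm_apply ha).clm_apply (hB.clm_apply hb)).add
    (hL.clm_apply ((hB'.clm_apply ha).clm_apply hb))).sub
    (((hH.clm_apply hb).clm_apply (hB.clm_apply ha)).add
      (hL.clm_apply ((hB'.clm_apply hb).clm_apply ha)))

/-- Positivity of `d (dψ ∘ B)` on a compact set is preserved by `C¹`-small changes of `B`. -/
lemma exists_forall_leviValue_pos [FiniteDimensional ℝ E] {K : Set E} (hK : IsCompact K)
    {ψ : E → ℝ} (hψ : ∀ z ∈ K, ContDiffAt ℝ ∞ ψ z) {B : E → E →L[ℝ] E}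
    (hB : ∀ z ∈ K, ContDiffAt ℝ ∞ B z)
    (hpos : ∀ z ∈ K, ∀ a ≠ 0, 0 < leviValue (fderiv ℝ ψ z) (fderiv ℝ (fderiv ℝ ψ) z) (B z)
      (fderiv ℝ B z) (B z a) a) :
    ∃ δ > 0, ∀ z ∈ K, ∀ (C : E →L[ℝ] E) (C' : E →L[ℝ] E →L[ℝ] E), dist C (B z) < δ →
      dist C' (fderiv ℝ B z) < δ → ∀ a ≠ 0,
        0 < leviValue (fderiv ℝ ψ z) (fderiv ℝ (fderiv ℝ ψ) z) C C' (C a) a := by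
  have : ProperSpace E := FiniteDimensional.proper ℝ E
  -- For a perturbation `q` of the value and the derivative of `B`, positivity at `(z, a)` is an
  -- open condition on `(q, (z, a))`; it holds for `q = 0`, and `(z, a)` ranges in a compact set.
  have hev : ∀ᶠ q : (E →L[ℝ] E) × (E →L[ℝ] E →L[ℝ] E) in 𝓝 0,
      ∀ p ∈ K ×ˢ Metric.sphere (0 : E) 1,
        0 < leviValue (fderiv ℝ ψ p.1) (fderiv ℝ (fderiv ℝ ψ) p.1) (B p.1 + q.1)
          (fderiv ℝ B p.1 + q.2) ((B p.1 + q.1) p.2) p.2 := by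
    refine (hK.prod (isCompact_sphere (0 : E) 1)).eventually_forall_of_forall_eventually ?_
    rintro p ⟨hp1, hp2⟩
    have hψ1 : ContDiffAt ℝ ∞ (fderiv ℝ ψ) p.1 := (hψ p.1 hp1).fderiv_right (by simp)
    have hψ2 : ContDiffAt ℝ ∞ (fderiv ℝ (fderiv ℝ ψ)) p.1 := hψ1.fderiv_right (by simp)
    have hB1 : ContDiffAt ℝ ∞ (fderiv ℝ B) p.1 := (hB p.1 hp1).fderiv_right (by simp)
    have hz : ContinuousAt (fun y : ((E →L[ℝ] E) × (E →L[ℝ] E →L[ℝ] E)) × E × E => y.2.1)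
      (0, p) := by fun_prop
    have ha : ContinuousAt (fun y : ((E →L[ℝ] E) × (E →L[ℝ] E →L[ℝ] E)) × E × E => y.2.2)
      (0, p) := by fun_prop
    have hu : ContinuousAt (fun y : ((E →L[ℝ] E) × (E →L[ℝ] E →L[ℝ] E)) × E × E => y.1.1)
      (0, p) := by fun_prop
    have hw : ContinuousAt (fun y : ((E →L[ℝ] E) × (E →L[ℝ] E →L[ℝ] E)) × E × E => y.1.2)
      (0, p) := by fun_prop
    have hBu := ((hB p.1 hp1).continuousAt.comp_of_eq hz rfl).add hu
    have hcont := ContinuousAt.leviValue (hψ1.continuousAt.comp_of_eq hz rfl)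
      (hψ2.continuousAt.comp_of_eq hz rfl) hBu ((hB1.continuousAt.comp_of_eq hz rfl).add hw)
      (hBu.clm_apply ha) ha
    refine hcont.eventually_const_lt ?_
    have h0 := hpos p.1 hp1 p.2 (ne_zero_of_mem_unit_sphere ⟨p.2, hp2⟩)
    simpa using h0
  rw [← Prod.mk_zero_zero, nhds_prod_eq, Filter.eventually_prod_iff] at hev
  obtain ⟨P, hP, P', hP', h⟩ := hev
  obtain ⟨δ, hδ, hδP⟩ := (Metric.eventually_nhds_iff (α := E →L[ℝ] E)).1 hP
  obtain ⟨δ', hδ', hδP'⟩ := (Metric.eventually_nhds_iff (α := E →L[ℝ] E →L[ℝ] E)).1 hP'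
  refine ⟨min δ δ', lt_min hδ hδ', fun z hz C C' hC hC' a ha => ?_⟩
  -- The inequality is quadratic in `a`, so it suffices to consider unit vectors.
  have hn : ‖a‖ ≠ 0 := norm_ne_zero_iff.2 ha
  have hu : ‖a‖⁻¹ • a ∈ Metric.sphere (0 : E) 1 := by simp [norm_smul, hn]
  have hCP : P (C - B z) := hδP (by
    rw [dist_zero_right, ← dist_eq_norm]
    exact hC.trans_le (min_le_left _ _))
  have hCP' : P' (C' - fderiv ℝ B z) :=
    hδP' (((dist_zero_right (C' - fderiv ℝ B z)).trans (dist_eq_norm C' _).symm).trans_lt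
      (hC'.trans_le (min_le_right _ _)))
  have h := h hCP hCP' (z, ‖a‖⁻¹ • a) ⟨hz, hu⟩
  simp only [add_sub_cancel] at h
  rw [map_smul, leviValue_smul_smul] at h
  exact pos_of_mul_pos_right h (mul_self_nonneg _)

end Levi

lemma dist_fderiv_le_dist_iteratedFDeriv_one {E F : Type*} [NormedAddCommGroup E] [NormedSpace ℝ E]
    [NormedAddCommGroup F] [NormedSpace ℝ F] (f g : E → F) (z : E) :
    dist (fderiv ℝ f z) (fderiv ℝ g z) ≤
      dist (iteratedFDeriv ℝ 1 f z) (iteratedFDeriv ℝ 1 g z) := by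
  rw [dist_eq_norm, dist_eq_norm]
  refine ContinuousLinearMap.opNorm_le_bound _ (norm_nonneg _) fun w => ?_
  have h := (iteratedFDeriv ℝ 1 f z - iteratedFDeriv ℝ 1 g z).le_opNorm fun _ => w
  simpa using h

namespace ComplexStructure

variable {E : Type v} [NormedAddCommGroup E] [NormedSpace ℂ E]
  {M : Type u} [TopologicalSpace M] [ChartedSpace E M]

lemma dist_iteratedFDeriv_lt_mem_nhds {k : ℕ∞} (J : ComplexStructure E M) (p : M) {j : ℕ}
    (hj : (j : ℕ∞) ≤ k) {K : Set E} (hK : IsCompact K) (hKp : K ⊆ (chartAt E p).target) {δ : ℝ}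
    (hδ : 0 < δ) :
    {J' : ComplexStructure E M | ∀ z ∈ K, dist (iteratedFDeriv ℝ j (J.inChart p) z)
      (iteratedFDeriv ℝ j (J'.inChart p) z) < δ} ∈ @nhds _ (ckTopology k) J := by
  refine nhds_mono (iInf_le_of_le p (iInf_le_of_le j (iInf_le _ hj))) ?_
  rw [nhds_induced]
  exact ⟨_, UniformOnFun.gen_mem_nhds _ {K : Set E | IsCompact K ∧ K ⊆ (chartAt E p).target} _
    ⟨hK, hKp⟩ (Metric.dist_mem_uniformity hδ), fun J' h => h⟩

/-- Being `C¹`-close on a compact part of a chart is a neighbourhood in the `C^k` topology,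
`k ≥ 1`. -/
lemma dist_inChart_lt_mem_nhds {k : ℕ∞} (hk : 1 ≤ k) (J : ComplexStructure E M) (p : M)
    {K : Set E} (hK : IsCompact K) (hKp : K ⊆ (chartAt E p).target) {δ : ℝ} (hδ : 0 < δ) :
    {J' : ComplexStructure E M | ∀ z ∈ K, dist (J'.inChart p z) (J.inChart p z) < δ ∧
      dist (fderiv ℝ (J'.inChart p) z) (fderiv ℝ (J.inChart p) z) < δ} ∈
        @nhds _ (ckTopology k) J := by
  filter_upwards [J.dist_iteratedFDeriv_lt_mem_nhds (k := k) (j := 0) p (by simp) hK hKp hδ,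
    J.dist_iteratedFDeriv_lt_mem_nhds (k := k) (j := 1) p (by simpa using hk) hK hKp hδ]
    with J' h0 h1 z hz
  have h0z := h0 z hz
  have h1z := h1 z hz
  rw [dist_comm] at h0z h1z
  rw [iteratedFDeriv_zero_eq_comp, iteratedFDeriv_zero_eq_comp] at h0z
  refine ⟨?_, (dist_fderiv_le_dist_iteratedFDeriv_one _ _ _).trans_lt h1z⟩
  rwa [Function.comp_apply, Function.comp_apply, LinearIsometryEquiv.dist_map] at h0z

variable {N : Type u} [TopologicalSpace N] [ChartedSpace E N] {π : N → M}

/-- The positivity of `-√-1 ∂∂̄φ` at a point of `N`, for the lift of a complex structure of `M`, can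
be read off from any other point of the same fibre: the two expressions of an automorphic function
in the lifts of one chart of `M` are proportional. -/
lemma negIDDbar_pos_of_same_fibre [IsManifold 𝓘(ℝ, E) ∞ N]
    {J' : ComplexStructure E N} {J : ComplexStructure E M}
    (h : J'.IsGaloisCovering J π) {φ : N → ℝ} (hφ : ContMDiff 𝓘(ℝ, E) 𝓘(ℝ, ℝ) ∞ φ)
    (hpos : ∀ x, 0 < φ x)
    (haut : ∀ γ : N ≃ₜ N, π ∘ γ = π → ∃ c : ℝ, ∀ x, φ (γ x) = c * φ x)
    {c : OpenPartialHomeomorph M E} (hc : c ∈ IsManifold.maximalAtlas 𝓘(ℝ, E) ∞ M)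
    {e : OpenPartialHomeomorph N E} (he : e ∈ IsManifold.maximalAtlas 𝓘(ℝ, E) ∞ N)
    (hec : ∀ y ∈ e.source, π y ∈ c.source ∧ e y = c (π y)) {z : E} (hz : z ∈ e.target)
    (hL : ∀ a ≠ 0, 0 < leviValue (fderiv ℝ (φ ∘ e.symm) z)
      (fderiv ℝ (fderiv ℝ (φ ∘ e.symm)) z) (J.inCoord c z) (fderiv ℝ (J.inCoord c) z)
      (J.inCoord c z a) a)
    {x : N} (hx : π x = π (e.symm z)) (a : TangentSpace 𝓘(ℝ, E) x) (ha : a ≠ 0) :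
    0 < J'.negIDDbar φ x ![J'.endo x a, a] := by
  obtain ⟨γ, hγ, hγx⟩ := h.regular _ _ hx.symm
  obtain ⟨r, hr⟩ := haut γ hγ
  have hr0 : 0 < r := pos_of_mul_pos_left (hr x ▸ hpos _) (hpos x).le
  have hsz := hec _ (e.map_target hz)
  rw [e.right_inv hz] at hsz
  obtain ⟨e', he', hxe', hec'⟩ := exists_lift_chart h.localDiffeo hc (x := x) (hx ▸ hsz.1)
  have hez : e' x = z := by rw [(hec' x hxe').2, hx, ← hsz.2]
  have hz' : z ∈ e'.target := hez ▸ e'.map_source hxe'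
  -- Near `z`, the inverses of the two lifted charts differ by the deck transformation `γ`.
  have hψ : φ ∘ e'.symm =ᶠ[𝓝 z] r • (φ ∘ e.symm) := by
    have hcont : ContinuousAt (γ ∘ e.symm) z :=
      γ.continuous.continuousAt.comp (e.continuousAt_symm hz)
    have hmem : e'.source ∈ 𝓝 ((γ ∘ e.symm) z) := by
      rw [Function.comp_apply, hγx]; exact e'.open_source.mem_nhds hxe'
    filter_upwards [e.open_target.mem_nhds hz, hcont.eventually_mem hmem] with w hw hw'
    rw [Function.comp_apply] at hw'
    have h1 : e' (γ (e.symm w)) = w := by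
      rw [(hec' _ hw').2, show π (γ (e.symm w)) = π (e.symm w) from congrFun hγ _,
        ← (hec _ (e.map_target hw)).2, e.right_inv hw]
    have h2 : e'.symm w = γ (e.symm w) :=
      (congrArg e'.symm h1.symm).trans (e'.left_inv hw')
    simp [h2, hr]
  have hJ : J'.inCoord e' =ᶠ[𝓝 z] J.inCoord c := by
    filter_upwards [e'.open_target.mem_nhds hz'] with w hw
    exact h.inCoord_lift_chart hc he' hec' hw
  have hd1 : fderiv ℝ (φ ∘ e'.symm) =ᶠ[𝓝 z] r • fderiv ℝ (φ ∘ e.symm) := by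
    filter_upwards [hψ.fderiv (𝕜 := ℝ)] with w hw
    rw [hw, fderiv_const_smul_field, Pi.smul_apply]
  have hd2 : fderiv ℝ (fderiv ℝ (φ ∘ e'.symm)) z = r • fderiv ℝ (fderiv ℝ (φ ∘ e.symm)) z :=
    hd1.fderiv_eq.trans ((((contDiffAt_comp_symm hφ he hz).fderiv_right (m := ∞)
      (by simp)).differentiableAt (by simp)).hasFDerivAt.const_smul r).fderiv
  -- The differential of a chart is injective.
  have ha' : chartDeriv e' x a ≠ 0 := fun h0 => ha <| by
    have h1 := OpenPartialHomeomorph.mfderiv_symm_mfderiv he' hxe' a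
    rw [← h1]
    exact (congrArg (mfderiv 𝓘(ℝ, E) 𝓘(ℝ, E) e'.symm (e' x)) h0).trans (map_zero _)
  rw [J'.negIDDbar_apply hφ he' hxe', J'.chartDeriv_endo he' hxe', hez, hd2,
    hd1.self_of_nhds, hJ.fderiv_eq, hJ.self_of_nhds, Pi.smul_apply,
    smul_leviValue]
  have := hL _ ha'
  positivity

/-- Around each point of `M`, the positivity of the Kähler form of an LCK potential persists under
`C¹`-small deformations. -/
lemma exists_mem_nhds_forall_negIDDbar_pos [FiniteDimensional ℂ E] [IsManifold 𝓘(ℝ, E) ∞ M]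
    [IsManifold 𝓘(ℝ, E) ∞ N] {k : ℕ∞} (hk : 1 ≤ k)
    {J₀ : ComplexStructure E N} {J : ComplexStructure E M}
    (h : J₀.IsGaloisCovering J π) {Ω : DiffForm E N 2} {φ : N → ℝ} (hΩ : J₀.IsKahlerForm Ω)
    (hφ : J₀.IsLCKPotential π Ω φ) (p : M) :
    ∃ U ∈ 𝓝 p, ∀ᶠ J' in @nhds _ (ckTopology k) J, ∀ x : N, π x ∈ U →
      ∀ a : TangentSpace 𝓘(ℝ, E) x, a ≠ 0 →
        0 < (pullback h.localDiffeo J').negIDDbar φ x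
          ![(pullback h.localDiffeo J').endo x a, a] := by
  have : FiniteDimensional ℝ E := FiniteDimensional.complexToReal E
  have : ProperSpace E := FiniteDimensional.proper ℝ E
  obtain ⟨q, rfl⟩ := h.surjective p
  have hc := IsManifold.chart_mem_maximalAtlas (I := 𝓘(ℝ, E)) (n := ∞) (π q)
  have hpc := mem_chart_source E (π q)
  set c := chartAt E (π q)
  obtain ⟨e, he, hqe, hec⟩ := exists_lift_chart h.localDiffeo hc hpc
  have htar : e.target ⊆ c.target := fun z hz => by
    have := hec _ (e.map_target hz)
    rw [e.right_inv hz] at this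
    rw [this.2]
    exact c.map_source this.1
  have hnhds : e.target ∈ 𝓝 (c (π q)) := by
    rw [← (hec q hqe).2]
    exact e.open_target.mem_nhds (e.map_source hqe)
  obtain ⟨K, hKn, hKe, hK⟩ := local_compact_nhds hnhds
  have hpos : ∀ z ∈ K, ∀ a ≠ 0, 0 < leviValue (fderiv ℝ (φ ∘ e.symm) z)
      (fderiv ℝ (fderiv ℝ (φ ∘ e.symm)) z) (J.inCoord c z) (fderiv ℝ (J.inCoord c) z)
      (J.inCoord c z a) a := by
    intro z hz a ha
    have hze := hKe hz
    have hs := e.map_target hze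
    have hJ : J₀.inCoord e =ᶠ[𝓝 z] J.inCoord c := by
      filter_upwards [e.open_target.mem_nhds hze] with w hw
      exact h.inCoord_lift_chart hc he hec hw
    have haa : chartDeriv e (e.symm z) (mfderiv 𝓘(ℝ, E) 𝓘(ℝ, E) e.symm z a) = a :=
      OpenPartialHomeomorph.mfderiv_mfderiv_symm he hze a
    have h1 := hΩ.positive (e.symm z) (mfderiv 𝓘(ℝ, E) 𝓘(ℝ, E) e.symm z a) fun h0 => ha <| by
      rw [← haa]
      exact (congrArg (chartDeriv e (e.symm z)) h0).trans (map_zero _)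
    rw [← hφ.potential, J₀.negIDDbar_apply hφ.smooth he hs, J₀.chartDeriv_endo he hs,
      e.right_inv hze, haa, hJ.fderiv_eq, hJ.self_of_nhds] at h1
    linarith
  obtain ⟨δ, hδ, hL⟩ := exists_forall_leviValue_pos hK
    (fun z hz => contDiffAt_comp_symm hφ.smooth he (hKe hz))
    (fun z hz => J.contDiffAt_inCoord hc (htar (hKe hz))) hpos
  refine ⟨c.source ∩ c ⁻¹' K, inter_mem (c.open_source.mem_nhds hpc)
    ((c.continuousAt hpc).preimage_mem_nhds hKn), ?_⟩
  filter_upwards [J.dist_inChart_lt_mem_nhds hk (π q) hK (hKe.trans htar) hδ] with J' hJ' x hx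
  obtain ⟨hxc, hxK⟩ := hx
  refine negIDDbar_pos_of_same_fibre (h.pullback J') hφ.smooth hφ.pos hφ.automorphic hc he hec
    (hKe hxK) (hL _ hxK _ _ (hJ' _ hxK).1 (hJ' _ hxK).2) ?_
  have h2 := hec _ (e.map_target (hKe hxK))
  rw [e.right_inv (hKe hxK)] at h2
  exact c.injOn hxc h2.1 h2.2

end ComplexStructure

end

/-! ### Openness -/

theorem mainTheorem4 {E : Type v} [NormedAddCommGroup E] [NormedSpace ℂ E]
    [FiniteDimensional ℂ E] {M : Type u} [TopologicalSpace M] [ChartedSpace E M]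
    [IsManifold 𝓘(ℝ, E) ∞ M] [T2Space M] [CompactSpace M] [ConnectedSpace M]
    (k : ℕ∞) (hk : 1 ≤ k) :
    IsOpen[ComplexStructure.ckTopology k]
      {J : ComplexStructure E M | J.IsLCKWithPotential} := by
  refine (@isOpen_iff_mem_nhds _ (ComplexStructure.ckTopology k) _).2 ?_
  rintro J ⟨N, _, _, _, J₀, π, Ω, φ, h, hΩ, hφ⟩
  choose U hU hpos using
    ComplexStructure.exists_mem_nhds_forall_negIDDbar_pos (k := k) hk h hΩ hφ
  obtain ⟨t, ht⟩ := CompactSpace.elim_nhds_subcover U hU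
  filter_upwards [(Filter.eventually_all_finset t).2 fun p _ => hpos p] with J' hJ'
  -- The covering and the potential are kept; only the complex structure of `N` changes.
  refine ⟨N, _, _, inferInstance, J'.pullback h.localDiffeo, π, _, φ, h.pullback J',
    ComplexStructure.isKahlerForm_negIDDbar _ hφ.smooth fun x => ?_,
    ⟨hφ.smooth, hφ.pos, hφ.proper, hφ.automorphic, rfl⟩⟩
  have hx : π x ∈ ⋃ p ∈ t, U p := ht ▸ Set.mem_univ _
  obtain ⟨p, hp, hxp⟩ := Set.mem_iUnion₂.1 hx
  exact hJ' p hp x hxp
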